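/- Let $\mathfrak A$ be a $C^*$-algebra, $H$ a Hilbert $\mathfrak A$-module, $\mathcal L(H)$ the $C^*$-algebra of adjointable operators on $H$ and $I$ its unit. For $T\in\mathcal L(H)$ let $\mathcal R(T)$, $\mathcal N(T)$ and $T^*$ be its range, null space and adjoint, and $|T|=(T^*T)^{1/2}$. A closed submodule $M\subseteq H$ is *orthogonally complemented* if $H=M+M^\perp$, where $M^\perp=\{x\in H:\langle x,y\rangle=0\text{ for all }y\in M\}$; then $P_M\in\mathcal L(H)$ denotes the projection from $H$ onto $M$. An operator $T\in\mathcal L(H)$ *has the polar decomposition* if there is a partial isometry $U\in\mathcal L(H)$ with $T=U|T|$ and $U^*U=P_{\overline{\mathcal R(T^*)}}$ (in particular $\overline{\mathcal R(T^*)}$ is orthogonally complemented). A pair $(P,Q)$ is a *quasi-projection pair* on $H$ if $P\in\mathcal L(H)$ is a projection ($P=P^*=P^2$), $Q\in\mathcal L(H)$ is an idempotent ($Q^2=Q$), and $$PQ^*P=PQP,\qquad PQ^*(I-P)=-PQ(I-P),\qquad (I-P)Q^*(I-P)=(I-P)Q(I-P).$$ For such a pair put $$T_1=P(I-Q),\quad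 T_2=(I-P)Q,\quad \widetilde{T_1}=T_1(2P-I),\quad \widetilde{T_2}=-T_2(2P-I),$$ $$H_1=\mathcal R(P)\cap\mathcal R(Q),\qquad H_4=\mathcal N(P)\cap\mathcal N(Q).$$ The pair is called *semi-harmonious* if $T_1$ and $T_2$ both have the polar decomposition. **Theorem.** For every quasi-projection pair $(P,Q)$ on $H$ the following statements are equivalent: 1. $(P,Q)$ is semi-harmonious; 2. $\overline{\mathcal R(T_1)}$ and $\overline{\mathcal R(T_2)}$ are both orthogonally complemented in $H$; 3. $\overline{\mathcal R(T_1^*)}$ and $\overline{\mathcal R(T_2^*)}$ are both orthogonally complemented in $H$; 4. $\overline{\mathcal R(\widetilde{T_1})}$ and $\overline{\mathcal R(\widetilde{T_2})}$ are both orthogonally complemented in $H$; 5. $\overline{\mathcal R(\widetilde{T_1}^*)}$ and $\overline{\mathcal R(\widetilde{T_2}^*)}$ are both orthogonally complemented in $H$; 6. $\overline{\mathcal R(T_1)}$ and $\overline{\mathcal R(T_1^*)}$ are both orthogonally complemented in $H$; 7. $T_1$ has the polar decomposition; 8. $\overline{\mathcal R(T_1^*)}$ and $\overline{\mathcal R(\widetilde{T_2}^*)}$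 are both orthogonally complemented in $H$; 9. $\overline{\mathcal R(T_2)}$ and $\overline{\mathcal R(T_2^*)}$ are both orthogonally complemented in $H$; 10. $T_2$ has the polar decomposition; 11. $\overline{\mathcal R(T_2^*)}$ and $\overline{\mathcal R(\widetilde{T_1}^*)}$ are both orthogonally complemented in $H$. In each case, $H_1$, $H_4$, $\mathcal R(Q)$, $\mathcal N(Q)$, $\overline{\mathcal R(T_i)}$ and $\overline{\mathcal R(\widetilde{T_i}^*)}$ $(i=1,2)$ are orthogonally complemented in $H$, and $$P=P_{\overline{\mathcal R(T_1)}}+P_{H_1},\qquad P_{\mathcal R(Q)}=P_{\overline{\mathcal R(\widetilde{T_2}^*)}}+P_{H_1},$$ $$I-P=P_{\overline{\mathcal R(T_2)}}+P_{H_4},\qquad P_{\mathcal N(Q)}=P_{\overline{\mathcal R(\widetilde{T_1}^*)}}+P_{H_4}.$$ -/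

import Mathlib

open scoped InnerProductSpace

set_option linter.unusedSectionVars false

namespace HilbertModule

section Operators

variable (A : Type*) {E : Type*} [NonUnitalCStarAlgebra A] [PartialOrder A] [StarOrderedRing A]
  [NormedAddCommGroup E] [NormedSpace ℂ E] [SMul A E] [CStarModule A E]

/-- `S` is an adjoint of `T` for the `A`-valued inner product. -/
def IsAdjointPair (T S : E →L[ℂ] E) : Prop :=
  ∀ x y : E, ⟪T x, y⟫_A = ⟪x, S y⟫_A

variable {A}

theorem ext_inner {x y : E} (h : ∀ z : E, ⟪z, x⟫_A = ⟪z, y⟫_A) : x = y := by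
  have h1 : ⟪x - y, x - y⟫_A = 0 := by
    rw [CStarModule.inner_sub_right, h (x - y), sub_self]
  exact sub_eq_zero.mp (CStarModule.inner_self.mp h1)

theorem IsAdjointPair.symm {T S : E →L[ℂ] E} (h : IsAdjointPair A T S) :
    IsAdjointPair A S T := fun x y => by
  rw [← CStarModule.star_inner, ← h y x, CStarModule.star_inner]

theorem IsAdjointPair.unique {T S S' : E →L[ℂ] E} (h : IsAdjointPair A T S)
    (h' : IsAdjointPair A T S') : S = S' := by
  ext y
  exact ext_inner (A := A) fun z => by rw [← h z y, h' z y]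

theorem IsAdjointPair.norm_mul_self_le {T S : E →L[ℂ] E} (h : IsAdjointPair A T S) :
    ‖T‖ * ‖T‖ ≤ ‖S * T‖ := by
  have key : ‖T‖ ≤ √‖S * T‖ := by
    refine T.opNorm_le_bound (Real.sqrt_nonneg _) fun x => ?_
    have h1 : ‖T x‖ ^ 2 ≤ ‖S * T‖ * ‖x‖ ^ 2 := by
      rw [CStarModule.norm_sq_eq A, h x (T x)]
      calc ‖⟪x, S (T x)⟫_A‖ ≤ ‖x‖ * ‖(S * T) x‖ := CStarModule.norm_inner_le E
        _ ≤ ‖x‖ * (‖S * T‖ * ‖x‖) := by gcongr; exact (S * T).le_opNorm x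
        _ = ‖S * T‖ * ‖x‖ ^ 2 := by ring
    rw [← Real.sqrt_sq (norm_nonneg x), ← Real.sqrt_mul (norm_nonneg _)]
    exact Real.le_sqrt_of_sq_le h1
  calc ‖T‖ * ‖T‖ ≤ √‖S * T‖ * √‖S * T‖ := by gcongr
    _ = ‖S * T‖ := Real.mul_self_sqrt (norm_nonneg _)

theorem IsAdjointPair.norm_le {T S : E →L[ℂ] E} (h : IsAdjointPair A T S) : ‖T‖ ≤ ‖S‖ := by
  rcases (norm_nonneg T).eq_or_lt with h0 | h0
  · rw [← h0]; exact norm_nonneg S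
  · exact le_of_mul_le_mul_right (h.norm_mul_self_le.trans (norm_mul_le S T)) h0

variable (A E)

/-- The algebra `𝓛(E)` of adjointable operators on the Hilbert `A`-module `E`, as a subalgebra of
the bounded operators. -/
def adjointable : Subalgebra ℂ (E →L[ℂ] E) where
  carrier := {T | ∃ S, IsAdjointPair A T S}
  mul_mem' := by
    rintro T T' ⟨S, h⟩ ⟨S', h'⟩
    exact ⟨S' * S, fun x y => (h (T' x) y).trans (h' x (S y))⟩
  add_mem' := by
    rintro T T' ⟨S, h⟩ ⟨S', h'⟩
    refine ⟨S + S', fun x y => ?_⟩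
    simp only [_root_.add_apply, CStarModule.inner_add_left,
      CStarModule.inner_add_right, h x y, h' x y]
  algebraMap_mem' := fun c => by
    refine ⟨star c • 1, fun x y => ?_⟩
    simp [Algebra.algebraMap_eq_smul_one]

variable {A E}

/-- The adjoint of an adjointable operator. -/
noncomputable instance : Star (adjointable A E) where
  star T := ⟨T.2.choose, T.1, T.2.choose_spec.symm⟩

theorem isAdjointPair_star (T : adjointable A E) : IsAdjointPair A T.1 (star T).1 :=
  T.2.choose_spec

theorem star_eq_of_isAdjointPair {T S : adjointable A E} (h : IsAdjointPair A T.1 S.1) :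
    star T = S :=
  Subtype.ext ((isAdjointPair_star T).unique h)

noncomputable instance : StarRing (adjointable A E) where
  star_involutive T := star_eq_of_isAdjointPair (isAdjointPair_star T).symm
  star_mul T S := star_eq_of_isAdjointPair fun x y =>
    (isAdjointPair_star T (S.1 x) y).trans (isAdjointPair_star S x _)
  star_add T S := star_eq_of_isAdjointPair fun x y => by
    have h1 := isAdjointPair_star T x y
    have h2 := isAdjointPair_star S x y
    simp only [Subalgebra.coe_add, _root_.add_apply, CStarModule.inner_add_left,
      CStarModule.inner_add_right, h1, h2]

instance : StarModule ℂ (adjointable A E) where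
  star_smul c T := star_eq_of_isAdjointPair fun x y => by
    have h1 := isAdjointPair_star T x y
    simp [h1]

instance : CStarRing (adjointable A E) where
  norm_mul_self_le T := (isAdjointPair_star T).norm_mul_self_le

theorem norm_star_le (T : adjointable A E) : ‖star T‖ ≤ ‖T‖ :=
  (isAdjointPair_star T).symm.norm_le

instance [CompleteSpace E] : CompleteSpace (adjointable A E) := by
  refine Metric.complete_of_cauchySeq_tendsto fun u hu => ?_
  have hu1 : CauchySeq fun n => (u n).1 := hu.map uniformContinuous_subtype_val
  have hu2 : CauchySeq fun n => (star (u n)).1 := by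
    rw [Metric.cauchySeq_iff] at hu ⊢
    intro ε hε
    obtain ⟨N, hN⟩ := hu ε hε
    refine ⟨N, fun m hm n hn => lt_of_le_of_lt ?_ (hN m hm n hn)⟩
    have h1 := norm_star_le (u m - u n)
    rw [star_sub] at h1
    rw [dist_eq_norm, dist_eq_norm]
    exact h1
  obtain ⟨T, hT⟩ := cauchySeq_tendsto_of_complete hu1
  obtain ⟨S, hS⟩ := cauchySeq_tendsto_of_complete hu2
  have hTS : IsAdjointPair A T S := fun x y => by
    have e1 : Filter.Tendsto (fun n => (u n).1 x) Filter.atTop (nhds (T x)) :=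
      ((ContinuousLinearMap.apply ℂ E x).continuous.tendsto T).comp hT
    have e2 : Filter.Tendsto (fun n => (star (u n)).1 y) Filter.atTop (nhds (S y)) :=
      ((ContinuousLinearMap.apply ℂ E y).continuous.tendsto S).comp hS
    have l1 := (CStarModule.continuous_inner (A := A) (E := E)).continuousAt.tendsto.comp
      (e1.prodMk_nhds (tendsto_const_nhds (x := y)))
    have l2 := (CStarModule.continuous_inner (A := A) (E := E)).continuousAt.tendsto.comp
      ((tendsto_const_nhds (x := x)).prodMk_nhds e2)
    refine tendsto_nhds_unique l1 (l2.congr fun n => ?_)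
    exact (isAdjointPair_star (u n) x y).symm
  exact ⟨⟨T, S, hTS⟩, tendsto_subtype_rng.mpr hT⟩

/-- `𝓛(E)` is a C⋆-algebra. -/
noncomputable instance [CompleteSpace E] : CStarAlgebra (adjointable A E) where

/-- The usual order of the C⋆-algebra `𝓛(E)`: `T ≤ S` iff `S - T` is self-adjoint with nonnegative
spectrum. -/
noncomputable instance [CompleteSpace E] : PartialOrder (adjointable A E) :=
  CStarAlgebra.spectralOrder (adjointable A E)

instance [CompleteSpace E] : StarOrderedRing (adjointable A E) :=
  CStarAlgebra.spectralOrderedRing (adjointable A E)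

/-- The range of an operator. -/
def range (T : adjointable A E) : Submodule ℂ E := LinearMap.range T.1.toLinearMap

/-- The null space of an operator. -/
def ker (T : adjointable A E) : Submodule ℂ E := LinearMap.ker T.1.toLinearMap

/-- The norm closure of the range of an operator. -/
def closedRange (T : adjointable A E) : Submodule ℂ E := (range T).topologicalClosure

variable (A)

/-- The orthogonal complement `M^⊥ = {x : ⟪x, y⟫ = 0 for all y ∈ M}`. -/
def orthogonal (M : Submodule ℂ E) : Submodule ℂ E where
  carrier := {x | ∀ y ∈ M, ⟪x, y⟫_A = 0}
  add_mem' := fun {a b} ha hb y hy => by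
    rw [CStarModule.inner_add_left, ha y hy, hb y hy, add_zero]
  zero_mem' := fun y _ => CStarModule.inner_zero_left
  smul_mem' := fun c x hx y hy => by
    rw [CStarModule.inner_smul_left_complex, hx y hy, smul_zero]

/-- `M` is orthogonally complemented: `E = M + M^⊥`. (Such an `M` equals `M^⊥⊥`, so it is
automatically a closed `A`-submodule.) -/
def IsOrthogonallyComplemented (M : Submodule ℂ E) : Prop :=
  M ⊔ orthogonal A M = ⊤

variable {A}

theorem orthogonal_symm {M : Submodule ℂ E} {x y : E} (hx : x ∈ M) (hy : y ∈ orthogonal A M) :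
    ⟪x, y⟫_A = 0 := by
  rw [← CStarModule.star_inner, hy x hx, star_zero]

theorem IsOrthogonallyComplemented.isCompl {M : Submodule ℂ E}
    (h : IsOrthogonallyComplemented A M) : IsCompl M (orthogonal A M) where
  disjoint := Submodule.disjoint_def.mpr fun x hx hx' =>
    CStarModule.inner_self.mp (hx' x hx)
  codisjoint := codisjoint_iff.mpr h

theorem inner_projection_left {M : Submodule ℂ E} (h : IsOrthogonallyComplemented A M) (x y : E) :
    ⟪M.projection (orthogonal A M) h.isCompl x, y⟫_A =
      ⟪x, M.projection (orthogonal A M) h.isCompl y⟫_A := by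
  have hmem := Submodule.projection_apply_mem h.isCompl
  have hsub : ∀ z : E, z - M.projection (orthogonal A M) h.isCompl z ∈ orthogonal A M := fun z => by
    rw [← Submodule.projection_apply_eq_zero_iff h.isCompl, map_sub,
      Submodule.projection_apply_of_mem_left h.isCompl (hmem z), sub_self]
  have h1 := orthogonal_symm (hmem x) (hsub y)
  have h2 := hsub x _ (hmem y)
  rw [CStarModule.inner_sub_right, sub_eq_zero] at h1
  rw [CStarModule.inner_sub_left, sub_eq_zero] at h2
  rw [h1, h2]

theorem norm_projection_le {M : Submodule ℂ E} (h : IsOrthogonallyComplemented A M) (x : E) :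
    ‖M.projection (orthogonal A M) h.isCompl x‖ ≤ 1 * ‖x‖ := by
  set p := M.projection (orthogonal A M) h.isCompl with hp
  have h1 : ‖p x‖ * ‖p x‖ ≤ ‖p x‖ * ‖x‖ := by
    have h2 : ⟪p x, p x⟫_A = ⟪p x, x⟫_A := by
      rw [← inner_projection_left h (p x) x,
        Submodule.projection_apply_of_mem_left h.isCompl (Submodule.projection_apply_mem _ x)]
    rw [← pow_two, CStarModule.norm_sq_eq A, h2]
    exact CStarModule.norm_inner_le E
  rw [one_mul]
  rcases (norm_nonneg (p x)).eq_or_lt with h0 | h0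
  · rw [← h0]; exact norm_nonneg x
  · exact le_of_mul_le_mul_left h1 h0

/-- The projection `P_M ∈ 𝓛(E)` onto an orthogonally complemented submodule `M`: the identity on
`M` and zero on `M^⊥`. -/
noncomputable def orthProj (M : Submodule ℂ E) (h : IsOrthogonallyComplemented A M) :
    adjointable A E :=
  ⟨(M.projection (orthogonal A M) h.isCompl).mkContinuous 1 (norm_projection_le h),
    (M.projection (orthogonal A M) h.isCompl).mkContinuous 1 (norm_projection_le h),
    inner_projection_left h⟩

theorem range_orthProj (M : Submodule ℂ E) (h : IsOrthogonallyComplemented A M) :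
    range (orthProj M h) = M :=
  Submodule.range_projection h.isCompl

theorem isStarProjection_orthProj (M : Submodule ℂ E) (h : IsOrthogonallyComplemented A M) :
    IsStarProjection (orthProj M h) where
  isIdempotentElem := by
    refine Subtype.ext (ContinuousLinearMap.ext fun x => ?_)
    exact Submodule.projection_apply_of_mem_left h.isCompl
      (Submodule.projection_apply_mem h.isCompl x)
  isSelfAdjoint := star_eq_of_isAdjointPair (inner_projection_left h)

/-- `T` has the polar decomposition: there is a partial isometry `U ∈ 𝓛(E)` with `T = U |T|` and
`U⋆ U` the projection onto the closure of the range of `T⋆` (in particular this closure is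
orthogonally complemented). Here `|T| = CFC.abs T` is the square root of `T⋆ T` in the
C⋆-algebra `𝓛(E)`. -/
def HasPolarDecomposition [CompleteSpace E] (T : adjointable A E) : Prop :=
  ∃ U : adjointable A E, U * star U * U = U ∧ T = U * CFC.abs T ∧
    ∃ h : IsOrthogonallyComplemented A (closedRange (star T)),
      star U * U = orthProj (closedRange (star T)) h

/-- `(P, Q)` is a quasi-projection pair: `P` is a projection and `Q` is an idempotent satisfying
three compatibility relations between `Q` and `Q⋆`. -/
structure IsQuasiProjectionPair (P Q : adjointable A E) : Prop where
  isStarProjection : IsStarProjection P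
  isIdempotentElem : IsIdempotentElem Q
  corner₁₁ : P * star Q * P = P * Q * P
  corner₁₂ : P * star Q * (1 - P) = -(P * Q * (1 - P))
  corner₂₂ : (1 - P) * star Q * (1 - P) = (1 - P) * Q * (1 - P)

/-- `T₁ = P (I - Q)`. -/
def T₁ (P Q : adjointable A E) : adjointable A E := P * (1 - Q)

/-- `T₂ = (I - P) Q`. -/
def T₂ (P Q : adjointable A E) : adjointable A E := (1 - P) * Q

/-- The twisted operator `T̃₁ = T₁ (2P - I)`. -/
def twT₁ (P Q : adjointable A E) : adjointable A E := T₁ P Q * (2 * P - 1)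

/-- The twisted operator `T̃₂ = -T₂ (2P - I)`. -/
def twT₂ (P Q : adjointable A E) : adjointable A E := -(T₂ P Q * (2 * P - 1))

/-- `H₁ = R(P) ∩ R(Q)`. -/
def H₁ (P Q : adjointable A E) : Submodule ℂ E := range P ⊓ range Q

/-- `H₄ = N(P) ∩ N(Q)`. -/
def H₄ (P Q : adjointable A E) : Submodule ℂ E := ker P ⊓ ker Q

/-- A quasi-projection pair is semi-harmonious if `T₁` and `T₂` both have the polar
decomposition. -/
def IsSemiHarmonious [CompleteSpace E] (P Q : adjointable A E) : Prop :=
  IsQuasiProjectionPair P Q ∧ HasPolarDecomposition (T₁ P Q) ∧ HasPolarDecomposition (T₂ P Q)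

end Operators

end HilbertModule

namespace HilbertModule

/-! ### Ranges, null spaces and orthogonal complements in a Hilbert module. -/

section General

variable {A E : Type*} [NonUnitalCStarAlgebra A] [PartialOrder A] [StarOrderedRing A]
  [NormedAddCommGroup E] [NormedSpace ℂ E] [SMul A E] [CStarModule A E]

/-! Put `J = 2 * P - 1`, a self-adjoint unitary. The three corner relations amount to `Q⋆ = J Q J`
(`IsQuasiProjectionPair.star_eq`). Consequently `T̃₁⋆ = J T₁⋆ = (1 - Q) P` and `T̃₂⋆ = -J T₂⋆ = Q (1
- P)`, while `T̃ᵢ` and `Tᵢ` have the same range. Since a unitary preserves complementability of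
closed ranges, the twists can be dropped from all the conditions.

The heart is that `closure R(T₂)` is complemented iff `closure R((1 - Q) P)` is. The former lies in
`N(P)`, the latter in `N(Q)`; both null spaces are complemented, `N(Q)` because the range of any
idempotent is (`IsOrthogonallyComplemented.range_of_isIdempotentElem`). In both cases the relative
orthogonal complement is `H₄ = N(P) ∩ N(Q)`. So the two conditions read `N(P) = closure R(T₂) + H₄`
and `N(Q) = closure R((1 - Q) P) + H₄`, and these are equivalent for arbitrary idempotents
(`closedRange_sup_inf_ker_swap`).

Hence `T₂` and `T₁⋆` are interchangeable, and so are `T₁` and `T₂⋆` by passing to `(1 - P, 1 - Q)`.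
As the polar decomposition of `T` means complementability for both `T` and `T⋆`
(`hasPolarDecomposition_iff`), every statement says that `closure R(T₁)` and `closure R(T₂)` are
complemented. The projection formulas are the same orthogonal decompositions. -/

theorem inner_star_right (T : adjointable A E) (x y : E) :
    ⟪x, (star T).1 y⟫_A = ⟪T.1 x, y⟫_A :=
  (isAdjointPair_star T x y).symm

theorem inner_star_left (T : adjointable A E) (x y : E) :
    ⟪(star T).1 x, y⟫_A = ⟪x, T.1 y⟫_A :=
  (isAdjointPair_star T).symm x y

theorem mul_apply (S T : adjointable A E) (x : E) : (S * T).1 x = S.1 (T.1 x) := rfl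

theorem apply_mem_range (T : adjointable A E) (x : E) : T.1 x ∈ range T := ⟨x, rfl⟩

theorem mem_ker {T : adjointable A E} {x : E} : x ∈ ker T ↔ T.1 x = 0 := Iff.rfl

theorem isClosed_ker (T : adjointable A E) : IsClosed (ker T : Set E) :=
  T.1.isClosed_ker

theorem range_le_closedRange (T : adjointable A E) : range T ≤ closedRange T :=
  Submodule.le_topologicalClosure _

theorem closedRange_le {T : adjointable A E} {M : Submodule ℂ E} (hM : IsClosed (M : Set E))
    (h : ∀ x, T.1 x ∈ M) : closedRange T ≤ M :=
  Submodule.topologicalClosure_minimal _ (by rintro _ ⟨x, rfl⟩; exact h x) hM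

theorem isClosed_closedRange (T : adjointable A E) : IsClosed (closedRange T : Set E) :=
  Submodule.isClosed_topologicalClosure _

theorem closedRange_le_closedRange {S T : adjointable A E} (h : ∀ x, S.1 x ∈ closedRange T) :
    closedRange S ≤ closedRange T :=
  closedRange_le (isClosed_closedRange T) h

theorem closedRange_mul_le (S T : adjointable A E) : closedRange (S * T) ≤ closedRange S :=
  closedRange_le_closedRange fun x => range_le_closedRange S ⟨T.1 x, rfl⟩

theorem closedRange_mul_of_mul_eq_one (S : adjointable A E) {T U : adjointable A E}
    (h : T * U = 1) : closedRange (S * T) = closedRange S := by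
  refine (closedRange_mul_le S T).antisymm ?_
  have := closedRange_mul_le (S * T) U
  rwa [mul_assoc, h, mul_one] at this

theorem closedRange_neg (T : adjointable A E) : closedRange (-T) = closedRange T := by
  have key : ∀ S : adjointable A E, closedRange (-S) ≤ closedRange S := fun S =>
    closedRange_le_closedRange fun x => neg_mem (range_le_closedRange S (apply_mem_range S x))
  exact (key T).antisymm (by simpa using key (-T))

theorem apply_mem_closedRange_mul (S : adjointable A E) {T : adjointable A E} {x : E}
    (hx : x ∈ closedRange T) : S.1 x ∈ closedRange (S * T) := by
  have h : range T ≤ ((closedRange (S * T)).comap S.1.toLinearMap) := by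
    rintro _ ⟨y, rfl⟩
    exact range_le_closedRange (S * T) ⟨y, rfl⟩
  exact Submodule.topologicalClosure_minimal _ h
    ((isClosed_closedRange (S * T)).preimage S.1.continuous) hx

theorem isClosed_setOf_inner_eq_zero (x : E) : IsClosed {y : E | ⟪x, y⟫_A = 0} :=
  isClosed_eq ((CStarModule.continuous_inner (A := A) (E := E)).comp
    (continuous_const.prodMk continuous_id)) continuous_const

theorem orthogonal_closedRange (T : adjointable A E) :
    orthogonal A (closedRange T) = ker (star T) := by
  ext x
  constructor
  · intro hx
    refine ext_inner (A := A) fun z => ?_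
    change ⟪z, (star T).1 x⟫_A = _
    rw [inner_star_right, CStarModule.inner_zero_right]
    exact orthogonal_symm (range_le_closedRange T ⟨z, rfl⟩) hx
  · intro hx y hy
    refine closure_minimal (s := (range T : Set E)) ?_ (isClosed_setOf_inner_eq_zero x) hy
    rintro _ ⟨z, rfl⟩
    change ⟪x, T.1 z⟫_A = 0
    rw [← inner_star_left, mem_ker.1 hx, CStarModule.inner_zero_left]

theorem mem_range_iff_of_isIdempotentElem {p : adjointable A E} (hp : IsIdempotentElem p) {x : E} :
    x ∈ range p ↔ p.1 x = x := by
  constructor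
  · rintro ⟨y, rfl⟩
    exact congrArg (fun T : adjointable A E => T.1 y) hp.eq
  · exact fun h => ⟨x, h⟩

theorem range_one_sub_of_isIdempotentElem {p : adjointable A E} (hp : IsIdempotentElem p) :
    range (1 - p) = ker p := by
  ext x
  rw [mem_range_iff_of_isIdempotentElem hp.one_sub, mem_ker]
  change x - p.1 x = x ↔ _
  simp

theorem ker_one_sub_of_isIdempotentElem {p : adjointable A E} (hp : IsIdempotentElem p) :
    ker (1 - p) = range p := by
  rw [← range_one_sub_of_isIdempotentElem hp.one_sub, sub_sub_cancel]

theorem isClosed_range_of_isIdempotentElem {p : adjointable A E} (hp : IsIdempotentElem p) :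
    IsClosed (range p : Set E) := by
  rw [← ker_one_sub_of_isIdempotentElem hp]
  exact isClosed_ker _

theorem closedRange_of_isIdempotentElem {p : adjointable A E} (hp : IsIdempotentElem p) :
    closedRange p = range p :=
  (closedRange_le (isClosed_range_of_isIdempotentElem hp) (apply_mem_range p)).antisymm
    (range_le_closedRange p)

theorem orthogonal_range_of_isStarProjection {p : adjointable A E} (hp : IsStarProjection p) :
    orthogonal A (range p) = ker p := by
  rw [← closedRange_of_isIdempotentElem hp.isIdempotentElem, orthogonal_closedRange,
    hp.isSelfAdjoint.star_eq]

theorem isOrthogonallyComplemented_range {p : adjointable A E} (hp : IsStarProjection p) :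
    IsOrthogonallyComplemented A (range p) := by
  rw [IsOrthogonallyComplemented, orthogonal_range_of_isStarProjection hp, eq_top_iff]
  intro x _
  rw [← add_sub_cancel (p.1 x) x]
  refine Submodule.add_mem_sup ⟨x, rfl⟩ ?_
  rw [← range_one_sub_of_isIdempotentElem hp.isIdempotentElem]
  exact ⟨x, rfl⟩

/-- A projection is determined by its range. -/
theorem eq_of_range_eq {p q : adjointable A E} (hp : IsStarProjection p) (hq : IsStarProjection q)
    (h : range p = range q) : p = q := by
  have hk : ker p = ker q := by
    rw [← orthogonal_range_of_isStarProjection hp, h, orthogonal_range_of_isStarProjection hq]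
  refine Subtype.ext (ContinuousLinearMap.ext fun x => ?_)
  have h1 : q.1 (p.1 x) = p.1 x :=
    (mem_range_iff_of_isIdempotentElem hq.isIdempotentElem).1 (h ▸ apply_mem_range p x)
  have h2 : (1 - p).1 x ∈ ker q := by
    rw [← hk, ← range_one_sub_of_isIdempotentElem hp.isIdempotentElem]
    exact ⟨x, rfl⟩
  have h3 : q.1 (x - p.1 x) = 0 := h2
  rw [map_sub, h1, sub_eq_zero] at h3
  exact h3.symm

theorem eq_orthProj {p : adjointable A E} (hp : IsStarProjection p) {M : Submodule ℂ E}
    (h : IsOrthogonallyComplemented A M) (hM : range p = M) : p = orthProj M h :=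
  eq_of_range_eq hp (isStarProjection_orthProj M h) (hM.trans (range_orthProj M h).symm)

theorem orthProj_apply_of_mem {M : Submodule ℂ E} (h : IsOrthogonallyComplemented A M) {x : E}
    (hx : x ∈ M) : (orthProj M h).1 x = x :=
  (mem_range_iff_of_isIdempotentElem (isStarProjection_orthProj M h).isIdempotentElem).1
    (by rwa [range_orthProj])

theorem orthProj_apply_of_mem_orthogonal {M : Submodule ℂ E}
    (h : IsOrthogonallyComplemented A M) {x : E} (hx : x ∈ orthogonal A M) :
    (orthProj M h).1 x = 0 := by
  rw [← mem_ker, ← orthogonal_range_of_isStarProjection (isStarProjection_orthProj M h),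
    range_orthProj]
  exact hx

theorem le_orthogonal_symm {M N : Submodule ℂ E} (h : N ≤ orthogonal A M) :
    M ≤ orthogonal A N :=
  fun _ hx _ hy => orthogonal_symm hx (h hy)

/-- The complement of `M` contains both `N` and the complement of `K`, and these together with `M`
span everything. -/
theorem isOrthogonallyComplemented_left_of_sup {M N K : Submodule ℂ E}
    (hK : IsOrthogonallyComplemented A K) (hsup : M ⊔ N = K) (hN : N ≤ orthogonal A M) :
    IsOrthogonallyComplemented A M := by
  have hle : orthogonal A K ≤ orthogonal A M := fun x hx y hy =>
    hx y (hsup ▸ Submodule.mem_sup_left hy)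
  rw [IsOrthogonallyComplemented, eq_top_iff, ← hK, ← hsup, sup_assoc, hsup]
  exact sup_le_sup_left (sup_le hN hle) M

/-- An orthogonal decomposition of an orthogonally complemented submodule splits its projection. -/
theorem exists_orthProj_eq_add {M N K : Submodule ℂ E}
    (hK : IsOrthogonallyComplemented A K) (hsup : M ⊔ N = K) (hN : N ≤ orthogonal A M) :
    ∃ (hM : IsOrthogonallyComplemented A M) (hN : IsOrthogonallyComplemented A N),
      orthProj K hK = orthProj M hM + orthProj N hN := by
  have hM' := isOrthogonallyComplemented_left_of_sup hK hsup hN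
  have hN' := isOrthogonallyComplemented_left_of_sup hK (sup_comm M N ▸ hsup)
    (le_orthogonal_symm hN)
  refine ⟨hM', hN', Subtype.ext (ContinuousLinearMap.ext fun x => ?_)⟩
  change _ = (orthProj M hM').1 x + (orthProj N hN').1 x
  obtain ⟨k, hk, z, hz, rfl⟩ := Submodule.mem_sup.1 ((eq_top_iff.1 hK) (Submodule.mem_top (x := x)))
  obtain ⟨m, hm, n, hn, rfl⟩ := Submodule.mem_sup.1 (hsup.symm ▸ hk)
  have hzM : z ∈ orthogonal A M := fun y hy => hz y (hsup ▸ Submodule.mem_sup_left hy)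
  have hzN : z ∈ orthogonal A N := fun y hy => hz y (hsup ▸ Submodule.mem_sup_right hy)
  simp only [map_add]
  rw [orthProj_apply_of_mem_orthogonal hK hz, orthProj_apply_of_mem_orthogonal hM' hzM,
    orthProj_apply_of_mem_orthogonal hN' hzN, ← map_add, orthProj_apply_of_mem hK hk,
    orthProj_apply_of_mem hM' hm, orthProj_apply_of_mem_orthogonal hM' (hN hn),
    orthProj_apply_of_mem hN' hn,
    orthProj_apply_of_mem_orthogonal hN' (le_orthogonal_symm hN hm)]
  simp

/-- This is the modular law. It turns complementability of `M` into a decomposition inside `K`. -/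
theorem sup_inf_orthogonal_of_le {M K : Submodule ℂ E} (h : IsOrthogonallyComplemented A M)
    (hMK : M ≤ K) : M ⊔ K ⊓ orthogonal A M = K := by
  rw [inf_comm, ← sup_inf_assoc_of_le _ hMK, h, top_inf_eq]

/-- Decompose `u⋆ x` along `closure R(T)` and `N(T⋆)`, then apply `u`, which carries these into
`closure R(u T)` and `N((u T)⋆)`. -/
theorem IsOrthogonallyComplemented.closedRange_unitary_mul {u T : adjointable A E}
    (hu : star u * u = 1) (hu' : u * star u = 1)
    (h : IsOrthogonallyComplemented A (closedRange T)) :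
    IsOrthogonallyComplemented A (closedRange (u * T)) := by
  rw [IsOrthogonallyComplemented, eq_top_iff]
  intro x _
  obtain ⟨m, hm, n, hn, hmn⟩ :=
    Submodule.mem_sup.1 ((eq_top_iff.1 h) (Submodule.mem_top (x := (star u).1 x)))
  have hx : x = u.1 m + u.1 n := by
    rw [← map_add, hmn, ← mul_apply, hu']; rfl
  rw [hx]
  refine Submodule.add_mem_sup (apply_mem_closedRange_mul u hm) ?_
  rw [orthogonal_closedRange, mem_ker] at hn ⊢
  rw [star_mul, mul_apply, ← mul_apply (star u) u, hu]
  exact hn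

/-- The range of an idempotent in `𝓛(E)` is orthogonally complemented. -/
theorem IsOrthogonallyComplemented.range_of_isIdempotentElem [CompleteSpace E]
    {q : adjointable A E} (hq : IsIdempotentElem q) :
    IsOrthogonallyComplemented A (range q) := by
  have hq' : star q * star q = star q := by rw [← star_mul, hq.eq]
  -- Since `c² = 1 + (q⋆ - q)⋆ (q⋆ - q) ≥ 1`, the element `c` has a right inverse. Writing `c = q -
  -- (1 - q⋆)` then exhibits the identity as a sum of operators with values in `R(q)` and `N(q⋆) =
  -- R(q)^⊥`.
  set c : adjointable A E := q + star q - 1 with hc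
  have hcc : c * c = 1 + star (star q - q) * (star q - q) := by
    simp only [hc, star_sub, star_star, mul_sub, sub_mul, mul_add, add_mul, hq.eq, hq', mul_one,
      one_mul]
    abel
  have hu : IsUnit (c * c) := by
    refine CStarAlgebra.isUnit_of_le 1 ?_ isStrictlyPositive_one
    rw [hcc]
    exact le_add_of_nonneg_right (star_mul_self_nonneg _)
  obtain ⟨d, hd⟩ := hu.exists_right_inv
  rw [IsOrthogonallyComplemented, ← closedRange_of_isIdempotentElem hq, orthogonal_closedRange,
    closedRange_of_isIdempotentElem hq, eq_top_iff]
  intro x _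
  have hx : x = q.1 ((c * d).1 x) + ((1 - star q) * (-(c * d))).1 x := by
    have : (1 : adjointable A E) = q * (c * d) + (1 - star q) * (-(c * d)) := by
      rw [mul_neg, ← sub_eq_add_neg, ← sub_mul, sub_sub_eq_add_sub, ← hc, ← mul_assoc, hd]
    exact congrArg (fun T : adjointable A E => T.1 x) this
  rw [hx]
  refine Submodule.add_mem_sup ⟨_, rfl⟩ ?_
  rw [mem_ker, ← mul_apply, ← mul_assoc, mul_sub, mul_one, hq', sub_self, zero_mul]
  rfl

end General

end HilbertModule

namespace HilbertModule

/-! ### Partial isometries and the polar decomposition. -/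

section Polar

variable {A E : Type*} [NonUnitalCStarAlgebra A] [PartialOrder A] [StarOrderedRing A]
  [NormedAddCommGroup E] [NormedSpace ℂ E] [CompleteSpace E] [SMul A E] [CStarModule A E]

theorem orthProj_mul_eq_iff {M : Submodule ℂ E} (h : IsOrthogonallyComplemented A M)
    {T : adjointable A E} : orthProj M h * T = T ↔ range T ≤ M := by
  constructor
  · rintro hT _ ⟨x, rfl⟩
    have := apply_mem_range (orthProj M h) (T.1 x)
    rwa [range_orthProj, ← mul_apply, hT] at this
  · exact fun hT => Subtype.ext <| ContinuousLinearMap.ext fun x =>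
      orthProj_apply_of_mem h (hT ⟨x, rfl⟩)

theorem mul_orthProj_closedRange_star {T : adjointable A E}
    (h : IsOrthogonallyComplemented A (closedRange (star T))) :
    T * orthProj _ h = T := by
  have := (orthProj_mul_eq_iff h).2 (range_le_closedRange (star T))
  simpa [(isStarProjection_orthProj _ h).isSelfAdjoint.star_eq] using congrArg star this

/-- A bounded operator carrying `S x` to `T x` and supported on the closure of the range of `S`. -/
theorem exists_extension {S T : adjointable A E} (hST : ∀ x, ‖T.1 x‖ ≤ ‖S.1 x‖)
    (h : IsOrthogonallyComplemented A (closedRange S)) :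
    ∃ U : E →L[ℂ] E, (∀ x, U (S.1 x) = T.1 x) ∧ ∀ x, U ((orthProj _ h).1 x) = U x := by
  have hmem : ∀ x, (orthProj _ h).1 x ∈ closedRange S := fun x => by
    have := apply_mem_range (orthProj _ h) x
    rwa [range_orthProj] at this
  -- `S` is viewed as a map with dense range into `closedRange S`; the bound `hST` lets `T` factor
  -- through it, and the projection extends the factor to all of `E`.
  let e : E →ₗ[ℂ] closedRange S :=
    S.1.toLinearMap.codRestrict (closedRange S) fun x => range_le_closedRange S ⟨x, rfl⟩
  have he : DenseRange e := by
    intro y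
    rw [closure_subtype]
    refine closure_mono ?_ y.2
    rintro _ ⟨x, rfl⟩
    exact ⟨e x, ⟨x, rfl⟩, rfl⟩
  have hn : ∃ C : ℝ, ∀ x, ‖T.1.toLinearMap x‖ ≤ C * ‖e x‖ :=
    ⟨1, fun x => (hST x).trans_eq (one_mul _).symm⟩
  refine ⟨(T.1.toLinearMap.extendOfNorm e).comp
    ((orthProj _ h).1.codRestrict (closedRange S) hmem), fun x => ?_, fun x => ?_⟩
  · refine Eq.trans (congrArg (T.1.toLinearMap.extendOfNorm e) (Subtype.ext ?_))
      (LinearMap.extendOfNorm_eq he hn x)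
    exact orthProj_apply_of_mem h (range_le_closedRange S ⟨x, rfl⟩)
  · refine congrArg (T.1.toLinearMap.extendOfNorm e) (Subtype.ext ?_)
    exact orthProj_apply_of_mem h (hmem x)

theorem norm_apply_eq_of_star_mul_self_eq {S T : adjointable A E}
    (hST : star S * S = star T * T) (x : E) : ‖S.1 x‖ = ‖T.1 x‖ := by
  have h : ⟪S.1 x, S.1 x⟫_A = ⟪T.1 x, T.1 x⟫_A := by
    rw [← inner_star_right, ← mul_apply, hST, mul_apply, inner_star_right]
  rw [CStarModule.norm_eq_sqrt_norm_inner_self (A := A), h,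
    ← CStarModule.norm_eq_sqrt_norm_inner_self]

theorem extension_apply_mem {S T : adjointable A E} {U : E →L[ℂ] E}
    (hU : ∀ x, U (S.1 x) = T.1 x) {h : IsOrthogonallyComplemented A (closedRange S)}
    (hUp : ∀ x, U ((orthProj _ h).1 x) = U x) (x : E) : U x ∈ closedRange T := by
  rw [← hUp]
  have hle : closedRange S ≤ (closedRange T).comap U.toLinearMap :=
    closedRange_le ((isClosed_closedRange T).preimage U.continuous) fun x => by
      change U (S.1 x) ∈ closedRange T
      rw [hU]
      exact range_le_closedRange T ⟨x, rfl⟩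
  refine hle ?_
  have := apply_mem_range (orthProj _ h) x
  rwa [range_orthProj] at this

/-- If `S⋆ S = T⋆ T` and the closures of the ranges of `S` and `T` are orthogonally complemented,
then `S x ↦ T x` extends to an adjointable partial isometry between these closures. -/
theorem exists_partialIsometry {S T : adjointable A E} (hST : star S * S = star T * T)
    (hS : IsOrthogonallyComplemented A (closedRange S))
    (hT : IsOrthogonallyComplemented A (closedRange T)) :
    ∃ U : adjointable A E, U * S = T ∧ U * orthProj _ hS = U ∧ star U * U = orthProj _ hS := by
  obtain ⟨U, hU, hUp⟩ := exists_extension (fun x => (norm_apply_eq_of_star_mul_self_eq hST x).ge) hS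
  obtain ⟨V, hV, hVp⟩ := exists_extension (fun x => (norm_apply_eq_of_star_mul_self_eq hST x).le) hT
  have hcont : ∀ {f g : E → E}, Continuous f → Continuous g →
      Continuous fun x => ⟪f x, g x⟫_A := fun hf hg =>
    (CStarModule.continuous_inner (A := A) (E := E)).comp (hf.prodMk hg)
  -- On the ranges, the adjoint relation between `U` and `V` is `S⋆ S = T⋆ T`. Continuity extends it
  -- to the closures one variable at a time, and the projections extend it to `E`.
  have h0 : ∀ a b, ⟪U (S.1 a), T.1 b⟫_A = ⟪S.1 a, V (T.1 b)⟫_A := fun a b => by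
    rw [hU, hV, ← inner_star_left, ← inner_star_left S, ← mul_apply, ← mul_apply, hST]
  have h1 : ∀ x ∈ closedRange S, ∀ b, ⟪U x, T.1 b⟫_A = ⟪x, V (T.1 b)⟫_A := fun x hx b =>
    closure_minimal (s := (range S : Set E)) (t := {x | ⟪U x, T.1 b⟫_A = ⟪x, V (T.1 b)⟫_A})
      (by rintro _ ⟨a, rfl⟩; exact h0 a b)
      (isClosed_eq (hcont U.continuous continuous_const)
        (hcont continuous_id continuous_const)) hx
  have h2 : ∀ x ∈ closedRange S, ∀ y ∈ closedRange T, ⟪U x, y⟫_A = ⟪x, V y⟫_A := fun x hx y hy =>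
    closure_minimal (s := (range T : Set E)) (t := {y | ⟪U x, y⟫_A = ⟪x, V y⟫_A})
      (by rintro _ ⟨b, rfl⟩; exact h1 x hx b)
      (isClosed_eq (hcont continuous_const continuous_id)
        (hcont continuous_const V.continuous)) hy
  have hp : ∀ {M : Submodule ℂ E} (h : IsOrthogonallyComplemented A M) (x y : E),
      ⟪(orthProj M h).1 x, y⟫_A = ⟪x, (orthProj M h).1 y⟫_A := fun h => inner_projection_left h
  have hmem : ∀ {M : Submodule ℂ E} (h : IsOrthogonallyComplemented A M) (x : E),
      (orthProj M h).1 x ∈ M := fun {M} h x => by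
    have := apply_mem_range (orthProj M h) x
    rwa [range_orthProj] at this
  have hUV : IsAdjointPair A U V := fun x y => by
    calc ⟪U x, y⟫_A = ⟪(orthProj _ hT).1 (U x), y⟫_A := by
          rw [orthProj_apply_of_mem hT (extension_apply_mem hU hUp x)]
      _ = ⟪U ((orthProj _ hS).1 x), (orthProj _ hT).1 y⟫_A := by rw [hp, hUp]
      _ = ⟪(orthProj _ hS).1 x, V ((orthProj _ hT).1 y)⟫_A := h2 _ (hmem hS x) _ (hmem hT y)
      _ = ⟪x, V y⟫_A := by
          rw [hVp, hp, orthProj_apply_of_mem hS (extension_apply_mem hV hVp y)]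
  have hstar : star (⟨U, V, hUV⟩ : adjointable A E) = ⟨V, U, hUV.symm⟩ :=
    star_eq_of_isAdjointPair hUV
  have hUp' : (⟨U, V, hUV⟩ : adjointable A E) * orthProj _ hS = ⟨U, V, hUV⟩ :=
    Subtype.ext (ContinuousLinearMap.ext hUp)
  refine ⟨⟨U, V, hUV⟩, Subtype.ext (ContinuousLinearMap.ext hU), hUp', ?_⟩
  have hle : ∀ x ∈ closedRange S, V (U x) = x := fun x hx =>
    closure_minimal (s := (range S : Set E)) (t := {x | V (U x) = x})
      (by
        rintro _ ⟨a, rfl⟩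
        change V (U (S.1 a)) = S.1 a
        rw [hU, hV])
      (isClosed_eq (V.continuous.comp U.continuous) continuous_id) hx
  rw [hstar]
  refine Subtype.ext (ContinuousLinearMap.ext fun x => ?_)
  change V (U x) = (orthProj _ hS).1 x
  rw [← hUp, hle _ (hmem hS x)]

theorem star_abs (T : adjointable A E) : star (CFC.abs T) = CFC.abs T :=
  (CFC.abs_nonneg T).isSelfAdjoint.star_eq

theorem star_abs_mul_abs (T : adjointable A E) :
    star (CFC.abs T) * CFC.abs T = star T * T := by
  rw [star_abs, CFC.abs_mul_abs]

theorem closedRange_abs {T : adjointable A E} (h : IsOrthogonallyComplemented A (closedRange T))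
    (h' : IsOrthogonallyComplemented A (closedRange (star T))) :
    closedRange (CFC.abs T) = closedRange (star T) := by
  apply le_antisymm
  -- `‖|T| x‖ = ‖T x‖`, so `|T|` vanishes wherever `T` does, in particular on the complement of
  -- `closure R(T⋆)`.
  · have h1 : CFC.abs T * orthProj _ h' = CFC.abs T := by
      have h2 : T * (1 - orthProj _ h') = 0 := by
        rw [mul_sub, mul_one, mul_orthProj_closedRange_star, sub_self]
      refine (sub_eq_zero.1 ?_).symm
      refine Subtype.ext (ContinuousLinearMap.ext fun x => ?_)
      change (CFC.abs T).1 x - (CFC.abs T).1 ((orthProj _ h').1 x) = 0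
      rw [← map_sub, ← norm_eq_zero, norm_apply_eq_of_star_mul_self_eq (star_abs_mul_abs T),
        norm_eq_zero]
      exact congrArg (fun R : adjointable A E => R.1 x) h2
    refine closedRange_le (isClosed_closedRange _) fun x =>
      (orthProj_mul_eq_iff h').1 ?_ (apply_mem_range _ x)
    simpa [star_abs, (isStarProjection_orthProj _ h').isSelfAdjoint.star_eq] using congrArg star h1
  -- Only the component of `x` in `closure R(T)` contributes to `T⋆ x`, so `T⋆ x` lies in the
  -- closure of `R(T⋆ T) = R(|T|²)`.
  · have h1 : star T * orthProj _ h = star T := by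
      have := (orthProj_mul_eq_iff h).2 (range_le_closedRange T)
      simpa [(isStarProjection_orthProj _ h).isSelfAdjoint.star_eq] using congrArg star this
    refine closedRange_le (isClosed_closedRange _) fun x => ?_
    rw [← h1, mul_apply]
    have hx := apply_mem_range (orthProj _ h) x
    rw [range_orthProj] at hx
    have := apply_mem_closedRange_mul (star T) hx
    rw [← CFC.abs_mul_abs] at this
    exact closedRange_mul_le _ _ this

/-- An adjointable operator has the polar decomposition iff the closures of its range and of the
range of its adjoint are orthogonally complemented. -/
theorem hasPolarDecomposition_iff (T : adjointable A E) :
    HasPolarDecomposition T ↔ IsOrthogonallyComplemented A (closedRange T) ∧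
      IsOrthogonallyComplemented A (closedRange (star T)) := by
  constructor
  · rintro ⟨U, hU, hT, h', hUU⟩
    refine ⟨?_, h'⟩
    have hproj : IsStarProjection (U * star U) :=
      ⟨by rw [IsIdempotentElem, ← mul_assoc, hU], .mul_star_self U⟩
    suffices h : closedRange T = range (U * star U) from
      h ▸ isOrthogonallyComplemented_range hproj
    apply le_antisymm
    · refine closedRange_le (isClosed_range_of_isIdempotentElem hproj.isIdempotentElem) fun x => ?_
      have : T = U * star U * T := by rw [hT, ← mul_assoc, hU]
      rw [this]
      exact apply_mem_range (U * star U) (T.1 x)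
    -- `U⋆ x` lies in `closure R(T⋆)`, hence in `closure R(|T|)` because `T⋆ = |T| U⋆`; `U` then
    -- carries it into `closure R(U |T|) = closure R(T)`.
    · rintro _ ⟨x, rfl⟩
      change (U * star U).1 x ∈ closedRange T
      have hle : closedRange (star T) ≤ closedRange (CFC.abs T) := by
        have : star T = CFC.abs T * star U := by
          conv_lhs => rw [hT]
          rw [star_mul, star_abs]
        rw [this]
        exact closedRange_mul_le _ _
      have hmem : (star U).1 x ∈ closedRange (star T) := by
        refine (orthProj_mul_eq_iff h').1 ?_ (apply_mem_range _ x)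
        rw [← hUU]
        simpa [mul_assoc] using congrArg star hU
      have := apply_mem_closedRange_mul U (hle hmem)
      rwa [← hT] at this
  · rintro ⟨h, h'⟩
    have habs := closedRange_abs h h'
    have hA : IsOrthogonallyComplemented A (closedRange (CFC.abs T)) := habs ▸ h'
    obtain ⟨U, hUT, hUp, hUU⟩ := exists_partialIsometry (star_abs_mul_abs T) hA h
    refine ⟨U, by rw [mul_assoc, hUU, hUp], hUT.symm, h', hUU.trans ?_⟩
    exact eq_orthProj (isStarProjection_orthProj _ hA) h' ((range_orthProj _ hA).trans habs)

end Polar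

/-! ### Ring identities for corners and for the symmetry `2p - 1`. -/

section Ring

variable {R : Type*} [Ring R]

theorem peirce_decomposition (p s : R) :
    s = p * s * p + p * s * (1 - p) + (1 - p) * s * p + (1 - p) * s * (1 - p) := by
  noncomm_ring

theorem peirce_twist (p q : R) :
    p * q * p + -(p * q * (1 - p)) + -((1 - p) * q * p) + (1 - p) * q * (1 - p) =
      (2 * p - 1) * q * (2 * p - 1) := by
  noncomm_ring

theorem two_mul_sub_one_mul {p : R} (hp : IsIdempotentElem p) : (2 * p - 1) * p = p := by
  rw [sub_mul, mul_assoc, hp.eq, two_mul, one_mul, add_sub_cancel_right]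

theorem two_mul_sub_one_mul_self {p : R} (hp : IsIdempotentElem p) :
    (2 * p - 1) * (2 * p - 1) = 1 := by
  have h : (2 * p - 1) * (2 * p) = 2 * p := by
    rw [two_mul p, mul_add, ← two_mul p, two_mul_sub_one_mul hp, ← two_mul]
  rw [mul_sub, h, mul_one, sub_sub_cancel]

theorem one_sub_mul_one_sub_mul (p : R) {q : R} (hq : IsIdempotentElem q) :
    (1 - q) * ((1 - p) * q) = (1 - q) * p * (-q) := by
  have : (1 - q) * q = 0 := by rw [sub_mul, one_mul, hq.eq, sub_self]
  rw [sub_mul 1 p q, one_mul, mul_sub, this, zero_sub, mul_neg, mul_assoc]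

theorem neg_mul_two_mul_sub_one (p x : R) : -(x * (2 * p - 1)) = x * (2 * (1 - p) - 1) := by
  noncomm_ring

end Ring

/-! ### Quasi-projection pairs: the symmetry and the relative complements. -/

section QuasiProjectionPair

variable {A E : Type*} [NonUnitalCStarAlgebra A] [PartialOrder A] [StarOrderedRing A]
  [NormedAddCommGroup E] [NormedSpace ℂ E] [SMul A E] [CStarModule A E]

/-- For idempotents, `N(P) = closure R((1 - P) Q) + N(P) ∩ N(Q)` passes to the pair with `P` and `Q`
interchanged. -/
theorem closedRange_sup_inf_ker_swap {P Q : adjointable A E} (hP : IsIdempotentElem P)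
    (hQ : IsIdempotentElem Q) (h : closedRange ((1 - P) * Q) ⊔ ker P ⊓ ker Q = ker P) :
    closedRange ((1 - Q) * P) ⊔ ker P ⊓ ker Q = ker Q := by
  apply le_antisymm
  · refine sup_le (closedRange_le (isClosed_ker Q) fun x => ?_) inf_le_right
    rw [mem_ker, ← mul_apply, ← mul_assoc, mul_sub, mul_one, hQ.eq, sub_self, zero_mul]
    rfl
  · intro x hx
    have h1 : (1 - P).1 x ∈ ker P := by
      rw [← range_one_sub_of_isIdempotentElem hP]
      exact ⟨x, rfl⟩
    rw [← h] at h1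
    obtain ⟨u, hu, k, hk, huk⟩ := Submodule.mem_sup.1 h1
    have hu' : (1 - Q).1 u ∈ closedRange ((1 - Q) * P) := by
      have h2 := apply_mem_closedRange_mul (1 - Q) hu
      rw [show (1 - Q) * ((1 - P) * Q) = (1 - Q) * P * (-Q) from one_sub_mul_one_sub_mul P hQ] at h2
      exact closedRange_mul_le _ _ h2
    have hkQ : Q.1 k = 0 := hk.2
    have hxQ : Q.1 x = 0 := hx
    -- Applying `Q` to `u + k = x - P x` gives `Q u = -Q P x`, so the two `Q`-terms on the right
    -- cancel.
    have hx' : x = ((1 - Q) * P).1 x + (1 - Q).1 u + k := by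
      change x = (P.1 x - Q.1 (P.1 x)) + (u - Q.1 u) + k
      have h4 : u + k = x - P.1 x := huk
      have h5 := congrArg Q.1 h4
      rw [map_add, map_sub, hkQ, hxQ, add_zero, zero_sub] at h5
      rw [h5, sub_neg_eq_add, eq_sub_of_add_eq h4]
      abel
    rw [hx']
    exact Submodule.add_mem_sup
      (add_mem (range_le_closedRange _ (apply_mem_range _ x)) hu') hk

variable {P Q : adjointable A E}

namespace IsQuasiProjectionPair

theorem corner₂₁ (h : IsQuasiProjectionPair P Q) :
    (1 - P) * star Q * P = -((1 - P) * Q * P) := by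
  have := congrArg star h.corner₁₂
  simp only [star_mul, star_neg, star_sub, star_one, star_star,
    h.isStarProjection.isSelfAdjoint.star_eq, ← mul_assoc] at this
  rw [this, neg_neg]

/-- The symmetry `2 P - 1` implements the adjoint of `Q`. -/
theorem star_eq (h : IsQuasiProjectionPair P Q) : star Q = (2 * P - 1) * Q * (2 * P - 1) := by
  rw [peirce_decomposition P (star Q), h.corner₁₁, h.corner₁₂, h.corner₂₁, h.corner₂₂]
  exact peirce_twist P Q

/-- This duality exchanges `T₁` with `T₂`, `T̃₁` with `T̃₂` and `H₁` with `H₄`, so only one half of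
each result needs a direct argument. -/
theorem one_sub (h : IsQuasiProjectionPair P Q) : IsQuasiProjectionPair (1 - P) (1 - Q) where
  isStarProjection := h.isStarProjection.one_sub
  isIdempotentElem := h.isIdempotentElem.one_sub
  corner₁₁ := by
    rw [star_sub, star_one, mul_sub (1 - P) 1 (star Q), mul_sub (1 - P) 1 Q, sub_mul _ _ (1 - P),
      sub_mul _ _ (1 - P), h.corner₂₂]
  corner₁₂ := by
    have : (1 - P) * 1 * P = 0 := by
      rw [mul_one, sub_mul, one_mul, h.isStarProjection.isIdempotentElem.eq, sub_self]
    rw [sub_sub_cancel, star_sub, star_one, mul_sub, mul_sub, sub_mul _ _ P, sub_mul _ _ P,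
      h.corner₂₁, this]
    abel
  corner₂₂ := by
    rw [sub_sub_cancel, star_sub, star_one, mul_sub, mul_sub, sub_mul, sub_mul, h.corner₁₁]

theorem symmetry_mul_self (h : IsQuasiProjectionPair P Q) : (2 * P - 1) * (2 * P - 1) = 1 :=
  two_mul_sub_one_mul_self h.isStarProjection.isIdempotentElem

theorem star_symmetry (h : IsQuasiProjectionPair P Q) : star (2 * P - 1) = 2 * P - 1 := by
  simp [h.isStarProjection.isSelfAdjoint.star_eq, two_mul]

theorem symmetry_mul_proj (h : IsQuasiProjectionPair P Q) : (2 * P - 1) * P = P :=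
  two_mul_sub_one_mul h.isStarProjection.isIdempotentElem

theorem symmetry_mul_star (h : IsQuasiProjectionPair P Q) :
    (2 * P - 1) * star Q = Q * (2 * P - 1) := by
  rw [h.star_eq, ← mul_assoc, ← mul_assoc, h.symmetry_mul_self, one_mul]

theorem star_twT₁ (h : IsQuasiProjectionPair P Q) : star (twT₁ P Q) = (1 - Q) * P := by
  rw [twT₁, T₁, star_mul, star_mul, h.star_symmetry, h.isStarProjection.isSelfAdjoint.star_eq,
    star_sub, star_one, ← mul_assoc, mul_sub, h.symmetry_mul_star, mul_one, sub_mul, mul_assoc Q,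
    h.symmetry_mul_proj, sub_mul, one_mul]

theorem twT₂_eq (P Q : adjointable A E) : twT₂ P Q = twT₁ (1 - P) (1 - Q) := by
  rw [twT₂, twT₁, T₁, T₂, sub_sub_cancel]
  exact neg_mul_two_mul_sub_one P _

theorem star_twT₂ (h : IsQuasiProjectionPair P Q) : star (twT₂ P Q) = Q * (1 - P) := by
  rw [twT₂_eq, h.one_sub.star_twT₁, sub_sub_cancel]

theorem symmetry_apply_of_mem_ker {x : E} (hx : x ∈ ker P) : (2 * P - 1).1 x = -x := by
  have hx' : P.1 x = 0 := hx
  rw [two_mul]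
  change P.1 x + P.1 x - x = -x
  rw [hx']
  abel

/-- On `N(P)` the symmetry `J = 2 * P - 1` is `-1`, so there `Q⋆ x = J Q J x = -J Q x` with `J`
invertible. -/
theorem ker_inf_ker_star (h : IsQuasiProjectionPair P Q) :
    ker P ⊓ ker (star Q) = ker P ⊓ ker Q := by
  ext x
  simp only [Submodule.mem_inf, and_congr_right_iff]
  intro hx
  have h1 : (star Q).1 x = -(2 * P - 1).1 (Q.1 x) := by
    rw [h.star_eq, mul_apply, symmetry_apply_of_mem_ker hx, map_neg]
    rfl
  have h2 : (2 * P - 1).1 ((star Q).1 x) = -(Q.1 x) := by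
    rw [h1, map_neg, ← mul_apply, h.symmetry_mul_self]
    rfl
  constructor
  · intro h3
    rw [mem_ker.1 h3, map_zero, zero_eq_neg] at h2
    exact h2
  · intro h3
    rw [mem_ker.1 h3, map_zero, neg_zero] at h1
    exact h1

theorem ker_inf_orthogonal_closedRange_T₂ (h : IsQuasiProjectionPair P Q) :
    ker P ⊓ orthogonal A (closedRange ((1 - P) * Q)) = ker P ⊓ ker Q := by
  rw [← h.ker_inf_ker_star, orthogonal_closedRange, star_mul,
    h.isStarProjection.one_sub.isSelfAdjoint.star_eq]
  ext x
  simp only [Submodule.mem_inf, and_congr_right_iff]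
  intro hx
  have : (1 - P).1 x = x := by
    change x - P.1 x = x
    rw [mem_ker.1 hx, sub_zero]
  rw [mem_ker, mem_ker, mul_apply, this]

/-- The compression `P Q P` does not take the value `1 / 2`. -/
theorem eq_zero_of_two_smul_apply (h : IsQuasiProjectionPair P Q) {y : E} (hy : P.1 y = y)
    (hQy : P.1 (Q.1 y) + P.1 (Q.1 y) = y) : y = 0 := by
  have hP : ∀ a b : E, ⟪P.1 a, b⟫_A = ⟪a, P.1 b⟫_A := fun a b => by
    rw [← inner_star_right, h.isStarProjection.isSelfAdjoint.star_eq]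
  have hPP : ∀ a : E, P.1 (P.1 a) = P.1 a := fun a =>
    congrArg (fun T : adjointable A E => T.1 a) h.isStarProjection.isIdempotentElem.eq
  have hJ : ∀ a : E, (2 * P - 1).1 a = P.1 a + P.1 a - a := fun a => by rw [two_mul]; rfl
  -- The vector is `w = J Q y` with `J = 2 * P - 1`, and `Q⋆ J Q = J Q² = J Q`. Pairing with `y`
  -- gives `⟪y, w⟫ = ⟪Q y, w⟫`; the hypotheses turn the left side into `⟪Q y, 2 P Q y⟫`, which
  -- leaves `⟪Q y, Q y⟫ = 0`.
  have h1 : (star Q).1 (P.1 (Q.1 y) + P.1 (Q.1 y) - Q.1 y) =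
      P.1 (Q.1 y) + P.1 (Q.1 y) - Q.1 y := by
    have h2 : star Q * (2 * P - 1) * Q = (2 * P - 1) * Q := by
      rw [h.star_eq, mul_assoc _ (2 * P - 1) (2 * P - 1), h.symmetry_mul_self, mul_one, mul_assoc,
        h.isIdempotentElem.eq]
    have := congrArg (fun T : adjointable A E => T.1 y) h2
    simpa only [mul_apply, hJ] using this
  have h3 : ⟪Q.1 y, Q.1 y⟫_A = 0 := by
    have h2 := inner_star_right Q y (P.1 (Q.1 y) + P.1 (Q.1 y) - Q.1 y)
    rw [h1] at h2
    have h4 : ⟪y, P.1 (Q.1 y) + P.1 (Q.1 y) - Q.1 y⟫_A =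
        ⟪Q.1 y, P.1 (Q.1 y) + P.1 (Q.1 y)⟫_A := by
      conv_lhs => rw [← hy, hP, map_sub, map_add, hPP, add_sub_cancel_right, ← hP, hy]
      conv_lhs => enter [2]; rw [← hQy]
      rw [CStarModule.inner_add_left, CStarModule.inner_add_right, hP]
    rw [h4, CStarModule.inner_sub_right, eq_comm, sub_eq_self] at h2
    exact h2
  have h5 : Q.1 y = 0 := CStarModule.inner_self.1 h3
  rw [← hQy, h5, map_zero, add_zero]

/-- For `x` in the left side, orthogonality gives `P x = P Q⋆ x`, and `Q⋆ (2 P - 1) x = (2 P - 1) Q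
x = 0` gives `2 Q⋆ P x = Q⋆ x`. Hence `2 P Q P x = 2 P Q⋆ P x = P x`, and
`eq_zero_of_two_smul_apply` forces `P x = 0`. -/
theorem ker_inf_orthogonal_closedRange_swap (h : IsQuasiProjectionPair P Q) :
    ker Q ⊓ orthogonal A (closedRange ((1 - Q) * P)) = ker P ⊓ ker Q := by
  have hPP : ∀ a : E, P.1 (P.1 a) = P.1 a := fun a =>
    congrArg (fun T : adjointable A E => T.1 a) h.isStarProjection.isIdempotentElem.eq
  rw [orthogonal_closedRange, star_mul, h.isStarProjection.isSelfAdjoint.star_eq, star_sub,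
    star_one]
  apply le_antisymm
  · rintro x ⟨hx, hx'⟩
    refine ⟨?_, hx⟩
    have h1 : P.1 (x - (star Q).1 x) = 0 := hx'
    have h2 : (star Q).1 (P.1 x + P.1 x - x) = 0 := by
      have h3 : star Q * (2 * P - 1) = (2 * P - 1) * Q := by
        rw [h.star_eq, mul_assoc _ (2 * P - 1) (2 * P - 1), h.symmetry_mul_self, mul_one]
      have h4 := congrArg (fun T : adjointable A E => T.1 x) h3
      simp only [mul_apply] at h4
      rw [mem_ker.1 hx, map_zero, two_mul] at h4
      exact h4
    refine h.eq_zero_of_two_smul_apply (hPP x) ?_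
    have h5 : P.1 (Q.1 (P.1 x)) = P.1 ((star Q).1 (P.1 x)) :=
      congrArg (fun T : adjointable A E => T.1 x) h.corner₁₁.symm
    rw [map_sub, sub_eq_zero] at h1 h2
    change P.1 (Q.1 (P.1 x)) + P.1 (Q.1 (P.1 x)) = P.1 x
    rw [h5, ← map_add, ← map_add, h2, h1]
  · rw [← h.ker_inf_ker_star]
    refine fun x hx => ⟨(h.ker_inf_ker_star.le hx).2, ?_⟩
    change P.1 (x - (star Q).1 x) = 0
    rw [mem_ker.1 hx.2, sub_zero]
    exact hx.1

theorem closedRange_T₂_le (h : IsQuasiProjectionPair P Q) :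
    closedRange ((1 - P) * Q) ≤ ker P := by
  rw [← range_one_sub_of_isIdempotentElem h.isStarProjection.isIdempotentElem]
  exact closedRange_le
    (isClosed_range_of_isIdempotentElem h.isStarProjection.isIdempotentElem.one_sub)
    fun x => ⟨Q.1 x, rfl⟩

theorem closedRange_swap_le (h : IsQuasiProjectionPair P Q) :
    closedRange ((1 - Q) * P) ≤ ker Q := by
  rw [← range_one_sub_of_isIdempotentElem h.isIdempotentElem]
  exact closedRange_le (isClosed_range_of_isIdempotentElem h.isIdempotentElem.one_sub)
    fun x => ⟨P.1 x, rfl⟩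

theorem closedRange_T₂_sup_eq_iff (h : IsQuasiProjectionPair P Q) :
    closedRange ((1 - P) * Q) ⊔ ker P ⊓ ker Q = ker P ↔
      closedRange ((1 - Q) * P) ⊔ ker P ⊓ ker Q = ker Q := by
  refine ⟨closedRange_sup_inf_ker_swap h.isStarProjection.isIdempotentElem h.isIdempotentElem, ?_⟩
  rw [inf_comm]
  exact closedRange_sup_inf_ker_swap h.isIdempotentElem h.isStarProjection.isIdempotentElem

/-! ### Comparing complementability of the ranges. -/

variable [CompleteSpace E]

theorem isOrthogonallyComplemented_closedRange_T₂_iff (h : IsQuasiProjectionPair P Q) :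
    IsOrthogonallyComplemented A (closedRange ((1 - P) * Q)) ↔
      closedRange ((1 - P) * Q) ⊔ ker P ⊓ ker Q = ker P := by
  rw [← h.ker_inf_orthogonal_closedRange_T₂]
  refine ⟨fun h1 => sup_inf_orthogonal_of_le h1 h.closedRange_T₂_le, fun h1 => ?_⟩
  refine isOrthogonallyComplemented_left_of_sup ?_ h1 inf_le_right
  rw [← range_one_sub_of_isIdempotentElem h.isStarProjection.isIdempotentElem]
  exact isOrthogonallyComplemented_range h.isStarProjection.one_sub

theorem isOrthogonallyComplemented_ker (h : IsQuasiProjectionPair P Q) :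
    IsOrthogonallyComplemented A (ker Q) := by
  rw [← range_one_sub_of_isIdempotentElem h.isIdempotentElem]
  exact .range_of_isIdempotentElem h.isIdempotentElem.one_sub

theorem isOrthogonallyComplemented_closedRange_swap_iff (h : IsQuasiProjectionPair P Q) :
    IsOrthogonallyComplemented A (closedRange ((1 - Q) * P)) ↔
      closedRange ((1 - Q) * P) ⊔ ker P ⊓ ker Q = ker Q := by
  rw [← h.ker_inf_orthogonal_closedRange_swap]
  refine ⟨fun h1 => sup_inf_orthogonal_of_le h1 h.closedRange_swap_le, fun h1 => ?_⟩
  exact isOrthogonallyComplemented_left_of_sup h.isOrthogonallyComplemented_ker h1 inf_le_right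

/-- The bridge between the two indices: both sides are decompositions with the same second summand
`N(P) ∩ N(Q)`, one of `N(P)` and one of `N(Q)`. -/
theorem isOrthogonallyComplemented_T₂_iff_star_twT₁ (h : IsQuasiProjectionPair P Q) :
    IsOrthogonallyComplemented A (closedRange (T₂ P Q)) ↔
      IsOrthogonallyComplemented A (closedRange (star (twT₁ P Q))) := by
  rw [h.star_twT₁, T₂, h.isOrthogonallyComplemented_closedRange_T₂_iff,
    h.isOrthogonallyComplemented_closedRange_swap_iff, h.closedRange_T₂_sup_eq_iff]

theorem T₂_one_sub (P Q : adjointable A E) : T₂ (1 - P) (1 - Q) = T₁ P Q := by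
  rw [T₁, T₂, sub_sub_cancel]

theorem isOrthogonallyComplemented_T₁_iff_star_twT₂ (h : IsQuasiProjectionPair P Q) :
    IsOrthogonallyComplemented A (closedRange (T₁ P Q)) ↔
      IsOrthogonallyComplemented A (closedRange (star (twT₂ P Q))) := by
  rw [twT₂_eq, ← T₂_one_sub, h.one_sub.isOrthogonallyComplemented_T₂_iff_star_twT₁]

theorem isOrthogonallyComplemented_star_mul_symmetry_iff (h : IsQuasiProjectionPair P Q)
    (T : adjointable A E) :
    IsOrthogonallyComplemented A (closedRange (star (T * (2 * P - 1)))) ↔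
      IsOrthogonallyComplemented A (closedRange (star T)) := by
  have hu : star (2 * P - 1) * (2 * P - 1) = 1 := by rw [h.star_symmetry, h.symmetry_mul_self]
  have hu' : (2 * P - 1) * star (2 * P - 1) = 1 := by rw [h.star_symmetry, h.symmetry_mul_self]
  rw [star_mul, h.star_symmetry]
  refine ⟨fun h1 => ?_, fun h1 => h1.closedRange_unitary_mul hu hu'⟩
  have := h1.closedRange_unitary_mul hu hu'
  rwa [← mul_assoc, h.symmetry_mul_self, one_mul] at this

theorem closedRange_twT₁ (h : IsQuasiProjectionPair P Q) :
    closedRange (twT₁ P Q) = closedRange (T₁ P Q) :=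
  closedRange_mul_of_mul_eq_one _ h.symmetry_mul_self

theorem closedRange_twT₂ (h : IsQuasiProjectionPair P Q) :
    closedRange (twT₂ P Q) = closedRange (T₂ P Q) := by
  rw [twT₂, closedRange_neg, closedRange_mul_of_mul_eq_one _ h.symmetry_mul_self]

theorem isOrthogonallyComplemented_star_twT₁_iff (h : IsQuasiProjectionPair P Q) :
    IsOrthogonallyComplemented A (closedRange (star (twT₁ P Q))) ↔
      IsOrthogonallyComplemented A (closedRange (star (T₁ P Q))) :=
  h.isOrthogonallyComplemented_star_mul_symmetry_iff _

theorem isOrthogonallyComplemented_star_twT₂_iff (h : IsQuasiProjectionPair P Q) :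
    IsOrthogonallyComplemented A (closedRange (star (twT₂ P Q))) ↔
      IsOrthogonallyComplemented A (closedRange (star (T₂ P Q))) := by
  rw [twT₂, star_neg, closedRange_neg]
  exact h.isOrthogonallyComplemented_star_mul_symmetry_iff _

/-- The orthogonal decompositions of `N(P)` and `N(Q)`. -/
theorem exists_one_sub_eq_add (h : IsQuasiProjectionPair P Q)
    (hT : IsOrthogonallyComplemented A (closedRange (T₂ P Q))) :
    ∃ (h₄ : IsOrthogonallyComplemented A (H₄ P Q))
      (hN : IsOrthogonallyComplemented A (ker Q))
      (hT₂ : IsOrthogonallyComplemented A (closedRange (T₂ P Q)))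
      (hS₁ : IsOrthogonallyComplemented A (closedRange (star (twT₁ P Q)))),
      1 - P = orthProj _ hT₂ + orthProj _ h₄ ∧
        orthProj _ hN = orthProj _ hS₁ + orthProj _ h₄ := by
  have hS := h.isOrthogonallyComplemented_T₂_iff_star_twT₁.1 hT
  have hsupT := h.isOrthogonallyComplemented_closedRange_T₂_iff.1 hT
  have hsupS := h.closedRange_T₂_sup_eq_iff.1 hsupT
  have hkP := range_one_sub_of_isIdempotentElem h.isStarProjection.isIdempotentElem
  have hK : IsOrthogonallyComplemented A (ker P) :=
    hkP ▸ isOrthogonallyComplemented_range h.isStarProjection.one_sub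
  obtain ⟨hM, h₄, h1⟩ := exists_orthProj_eq_add hK hsupT
    (h.ker_inf_orthogonal_closedRange_T₂.ge.trans inf_le_right)
  have hstar : star (twT₁ P Q) = (1 - Q) * P := h.star_twT₁
  rw [← hstar] at hsupS
  obtain ⟨hM', h₄', h2⟩ := exists_orthProj_eq_add h.isOrthogonallyComplemented_ker hsupS
    (by rw [hstar]; exact h.ker_inf_orthogonal_closedRange_swap.ge.trans inf_le_right)
  exact ⟨h₄, h.isOrthogonallyComplemented_ker, hT, hS,
    (eq_orthProj h.isStarProjection.one_sub hK hkP).trans h1, h2⟩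

theorem H₄_one_sub (h : IsQuasiProjectionPair P Q) : H₄ (1 - P) (1 - Q) = H₁ P Q := by
  rw [H₄, H₁, ker_one_sub_of_isIdempotentElem h.isStarProjection.isIdempotentElem,
    ker_one_sub_of_isIdempotentElem h.isIdempotentElem]

/-- The orthogonal decompositions of `R(P)` and `R(Q)`. -/
theorem exists_eq_add (h : IsQuasiProjectionPair P Q)
    (hT : IsOrthogonallyComplemented A (closedRange (T₁ P Q))) :
    ∃ (h₁ : IsOrthogonallyComplemented A (H₁ P Q))
      (hR : IsOrthogonallyComplemented A (range Q))
      (hT₁ : IsOrthogonallyComplemented A (closedRange (T₁ P Q)))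
      (hS₂ : IsOrthogonallyComplemented A (closedRange (star (twT₂ P Q)))),
      P = orthProj _ hT₁ + orthProj _ h₁ ∧
        orthProj _ hR = orthProj _ hS₂ + orthProj _ h₁ := by
  have := h.one_sub.exists_one_sub_eq_add (by rwa [T₂_one_sub])
  simpa only [T₂_one_sub, h.H₄_one_sub, ← twT₂_eq, sub_sub_cancel,
    ker_one_sub_of_isIdempotentElem h.isIdempotentElem] using this

end IsQuasiProjectionPair

end QuasiProjectionPair

end HilbertModule

/-! ### The equivalences and the projection formulas. -/

theorem mainTheorem1 {A E : Type*} [NonUnitalCStarAlgebra A] [PartialOrder A] [StarOrderedRing A]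
    [NormedAddCommGroup E] [NormedSpace ℂ E] [CompleteSpace E] [SMul A E] [CStarModule A E]
    (P Q : HilbertModule.adjointable A E) (hPQ : HilbertModule.IsQuasiProjectionPair P Q) :
    List.TFAE [
      HilbertModule.IsSemiHarmonious P Q,
      HilbertModule.IsOrthogonallyComplemented A
          (HilbertModule.closedRange (HilbertModule.T₁ P Q)) ∧
        HilbertModule.IsOrthogonallyComplemented A
          (HilbertModule.closedRange (HilbertModule.T₂ P Q)),
      HilbertModule.IsOrthogonallyComplemented A
          (HilbertModule.closedRange (star (HilbertModule.T₁ P Q))) ∧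
        HilbertModule.IsOrthogonallyComplemented A
          (HilbertModule.closedRange (star (HilbertModule.T₂ P Q))),
      HilbertModule.IsOrthogonallyComplemented A
          (HilbertModule.closedRange (HilbertModule.twT₁ P Q)) ∧
        HilbertModule.IsOrthogonallyComplemented A
          (HilbertModule.closedRange (HilbertModule.twT₂ P Q)),
      HilbertModule.IsOrthogonallyComplemented A
          (HilbertModule.closedRange (star (HilbertModule.twT₁ P Q))) ∧
        HilbertModule.IsOrthogonallyComplemented A
          (HilbertModule.closedRange (star (HilbertModule.twT₂ P Q))),
      HilbertModule.IsOrthogonallyComplemented A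
          (HilbertModule.closedRange (HilbertModule.T₁ P Q)) ∧
        HilbertModule.IsOrthogonallyComplemented A
          (HilbertModule.closedRange (star (HilbertModule.T₁ P Q))),
      HilbertModule.HasPolarDecomposition (HilbertModule.T₁ P Q),
      HilbertModule.IsOrthogonallyComplemented A
          (HilbertModule.closedRange (star (HilbertModule.T₁ P Q))) ∧
        HilbertModule.IsOrthogonallyComplemented A
          (HilbertModule.closedRange (star (HilbertModule.twT₂ P Q))),
      HilbertModule.IsOrthogonallyComplemented A
          (HilbertModule.closedRange (HilbertModule.T₂ P Q)) ∧
        HilbertModule.IsOrthogonallyComplemented A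
          (HilbertModule.closedRange (star (HilbertModule.T₂ P Q))),
      HilbertModule.HasPolarDecomposition (HilbertModule.T₂ P Q),
      HilbertModule.IsOrthogonallyComplemented A
          (HilbertModule.closedRange (star (HilbertModule.T₂ P Q))) ∧
        HilbertModule.IsOrthogonallyComplemented A
          (HilbertModule.closedRange (star (HilbertModule.twT₁ P Q)))] ∧
    (HilbertModule.IsSemiHarmonious P Q →
      ∃ (h₁ : HilbertModule.IsOrthogonallyComplemented A (HilbertModule.H₁ P Q))
        (h₄ : HilbertModule.IsOrthogonallyComplemented A (HilbertModule.H₄ P Q))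
        (hR : HilbertModule.IsOrthogonallyComplemented A (HilbertModule.range Q))
        (hN : HilbertModule.IsOrthogonallyComplemented A (HilbertModule.ker Q))
        (hT₁ : HilbertModule.IsOrthogonallyComplemented A
          (HilbertModule.closedRange (HilbertModule.T₁ P Q)))
        (hT₂ : HilbertModule.IsOrthogonallyComplemented A
          (HilbertModule.closedRange (HilbertModule.T₂ P Q)))
        (hS₁ : HilbertModule.IsOrthogonallyComplemented A
          (HilbertModule.closedRange (star (HilbertModule.twT₁ P Q))))
        (hS₂ : HilbertModule.IsOrthogonallyComplemented A
          (HilbertModule.closedRange (star (HilbertModule.twT₂ P Q)))),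
        P = HilbertModule.orthProj _ hT₁ + HilbertModule.orthProj _ h₁ ∧
        HilbertModule.orthProj _ hR = HilbertModule.orthProj _ hS₂ + HilbertModule.orthProj _ h₁ ∧
        1 - P = HilbertModule.orthProj _ hT₂ + HilbertModule.orthProj _ h₄ ∧
        HilbertModule.orthProj _ hN =
          HilbertModule.orthProj _ hS₁ + HilbertModule.orthProj _ h₄) := by
  have hp₁ := HilbertModule.hasPolarDecomposition_iff (HilbertModule.T₁ P Q)
  have hp₂ := HilbertModule.hasPolarDecomposition_iff (HilbertModule.T₂ P Q)
  have hs₁ := hPQ.isOrthogonallyComplemented_star_twT₁_iff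
  have hs₂ := hPQ.isOrthogonallyComplemented_star_twT₂_iff
  have h₂₁ := hPQ.isOrthogonallyComplemented_T₂_iff_star_twT₁.trans hs₁
  have h₁₂ := hPQ.isOrthogonallyComplemented_T₁_iff_star_twT₂.trans hs₂
  refine ⟨?_, fun h => ?_⟩
  · rw [HilbertModule.IsSemiHarmonious, hPQ.closedRange_twT₁, hPQ.closedRange_twT₂, hp₁, hp₂, hs₁,
      hs₂, ← h₂₁, ← h₁₂]
    -- Every entry of the list is by now a conjunction built from complementability of `closure
    -- R(T₁)` and of `closure R(T₂)`, apart from `hPQ` itself; propositional simplification makes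
    -- all entries equal.
    generalize HilbertModule.IsOrthogonallyComplemented A
      (HilbertModule.closedRange (HilbertModule.T₁ P Q)) = a
    generalize HilbertModule.IsOrthogonallyComplemented A
      (HilbertModule.closedRange (HilbertModule.T₂ P Q)) = b
    rw [and_iff_right hPQ, and_comm (a := b), and_self]
    intro p hp q hq
    simp only [List.mem_cons, List.not_mem_nil, or_false, or_self] at hp hq
    rw [hp, hq]
  · obtain ⟨h₁, hR, hT₁, hS₂, e₁, e₂⟩ := hPQ.exists_eq_add (hp₁.1 h.2.1).1
    obtain ⟨h₄, hN, hT₂, hS₁, e₃, e₄⟩ := hPQ.exists_one_sub_eq_add (hp₂.1 h.2.2).1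
    exact ⟨h₁, h₄, hR, hN, hT₁, hT₂, hS₁, hS₂, e₁, e₂, e₃, e₄⟩
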